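/- Let $\mathcal H$ be a separable infinite-dimensional complex Hilbert space. A bounded operator $T$ is called quasinilpotent if $\sigma(T)=\{0\}$; for such $T$ and $x\neq 0$ put $$k_x(T)=\limsup_{\lambda\to 0}\frac{\ln\|(\lambda-T)^{-1}x\|}{\ln\|(\lambda-T)^{-1}\|},\qquad \Lambda(T)=\{k_x(T):x\neq 0\}.$$ There exist an orthonormal basis $\{e_n\}_{n\ge 0}$ of $\mathcal H$, a bounded operator $A$ on $\mathcal H$ with $Ae_n=\frac{1}{n+1}e_{n+1}$ for all $n\ge 0$, and an enumeration $\{r_k\}_{k\ge 1}$ without repetition of the rational numbers in $(0,1]$, such that the operators $A_k=r_kA$ have the following properties. Each $A_k$ is quasinilpotent with $\Lambda(A_k)=\{1\}$; the norms $\|A_k\|$ are bounded, and the direct sum $\bigoplus_{k=1}^\infty A_k$, acting coordinatewise on the Hilbert space direct sum $\mathcal K=\bigoplus_{k=1}^\infty\mathcal H$, is quasinilpotent with $\Lambda\big(\bigoplus_{k=1}^\infty A_k\big)=(0,1]$. Consequently $$\Lambda\Big(\bigoplus_{k=1}^\infty A_k\Big)\supsetneq\overline{\bigcup_{k=1}^\infty\Lambda(A_k)}.$$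 -/

import Mathlib

open Filter Topology

noncomputable section

/-- A bounded operator is quasinilpotent if its spectrum is `{0}`. -/
def IsQuasinilpotent {E : Type*} [NormedAddCommGroup E] [InnerProductSpace ℂ E]
    (T : E →L[ℂ] E) : Prop :=
  spectrum ℂ T = {0}

/-- `k_x(T) = limsup_{z → 0} ln ‖(z - T)⁻¹ x‖ / ln ‖(z - T)⁻¹‖`, with `z → 0` through nonzero
complex numbers. For quasinilpotent `T` and `x ≠ 0` on a Hilbert space, every `z ≠ 0` lies in the
resolvent set, the denominator tends to `+∞`, and the quotient is bounded near `0` because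
`‖x‖ / (|z| + ‖T‖) ≤ ‖(z - T)⁻¹ x‖ ≤ ‖(z - T)⁻¹‖ ‖x‖`, so the real `limsup` is the usual one. -/
def localPower {E : Type*} [NormedAddCommGroup E] [InnerProductSpace ℂ E]
    (T : E →L[ℂ] E) (x : E) : ℝ :=
  limsup (fun z : ℂ => Real.log ‖resolvent T z x‖ / Real.log ‖resolvent T z‖) (𝓝[≠] 0)

/-- The power set `Λ(T) = {k_x(T) : x ≠ 0}`. -/
def operatorPowerSet {E : Type*} [NormedAddCommGroup E] [InnerProductSpace ℂ E]
    (T : E →L[ℂ] E) : Set ℝ :=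
  {t | ∃ x : E, x ≠ 0 ∧ localPower T x = t}

/-- The direct sum of a uniformly bounded sequence of operators on `H`, acting coordinatewise on
the Hilbert space direct sum of countably many copies of `H`. -/
def directSumOperator {H : Type*} [NormedAddCommGroup H] [InnerProductSpace ℂ H]
    (B : ℕ → H →L[ℂ] H) (hB : BddAbove (Set.range fun k => ‖B k‖)) :
    lp (fun _ : ℕ => H) 2 →L[ℂ] lp (fun _ : ℕ => H) 2 :=
  lp.mapCLM 2 B (K := ⨆ k, ‖B k‖) (Real.iSup_nonneg fun k => norm_nonneg (B k))
    (fun k => le_ciSup hB k)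

end

/-!
The growth of a resolvent is compared with `exp (s / ‖z‖)` as `z → 0`. Since `‖(r A) ^ n‖` is at
most `r ^ n / n!`, the Neumann series bounds the resolvent of `r A`, and up to the factor `‖x‖` its
orbit `z ↦ (z - r A)⁻¹ x`, by `exp (r / ‖z‖) / ‖z‖`. Conversely, if the orbit of `x` is bounded by
`M` on the circle `‖z‖ = ρ`, Cauchy's estimates give `‖(r A) ^ n x‖ ≤ ρ ^ (n + 1) * M`, whereas a
nonzero coordinate `x_m` of `x` gives `‖(r A) ^ n x‖ ≥ |x_m| r ^ n / (n! * (n + m).choose m)`.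
Multiplying the resulting inequality by `q ^ n` with `q < 1` and summing over `n` absorbs the
binomial coefficients and shows that `M` is at least a constant times `exp (q * r / ρ) / ρ`. Hence
the resolvent of `r A` and all its nonzero orbits have the same exponential type `r`, and every
local power is `1`.

In the direct sum, the orbit of `x` has as its type the supremum of the `r_k` over the support of
`x`, while the resolvent has type `1`. The local powers are therefore the suprema of nonempty
sets of rationals in `(0, 1]`, and by density these are all the real numbers in `(0, 1]`.
-/

theorem limsup_eq_of_eventually_lt_of_frequently_lt {α β : Type*}
    [ConditionallyCompleteLinearOrder β] [DenselyOrdered β] [NoMinOrder β] [NoMaxOrder β]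
    {f : Filter α} {u : α → β} {b : β} (hupper : ∀ y > b, ∀ᶠ a in f, u a < y)
    (hlower : ∀ y < b, ∃ᶠ a in f, y < u a) : limsup u f = b := by
  have ⟨c, hc⟩ := exists_gt b
  have ⟨d, hd⟩ := exists_lt b
  have hbdd : IsBoundedUnder (· ≤ ·) f u :=
    ⟨c, eventually_map.2 ((hupper c hc).mono fun _ h => h.le)⟩
  have hcobdd : IsCoboundedUnder (· ≤ ·) f u :=
    .of_frequently_ge ((hlower d hd).mono fun _ h => h.le)
  exact le_antisymm ((limsup_le_iff hcobdd hbdd).2 hupper) ((le_limsup_iff hcobdd hbdd).2 hlower)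

section Growth

variable {c q r s : ℝ}

theorem mul_exp_le_of_forall_mul_pow_div_factorial_le {a M : ℝ} (m : ℕ) (hq0 : 0 ≤ q) (hq1 : q < 1)
    (h : ∀ n : ℕ, c * (a ^ n / n.factorial) ≤ (n + m).choose m * M) :
    c * Real.exp (q * a) ≤ M / (1 - q) ^ (m + 1) := by
  have hexp : HasSum (fun n : ℕ => c * ((q * a) ^ n / n.factorial)) (c * Real.exp (q * a)) := by
    rw [Real.exp_eq_exp_ℝ]
    exact (NormedSpace.expSeries_div_hasSum_exp (q * a)).mul_left c
  have hgeom := (hasSum_choose_mul_geometric_of_norm_lt_one m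
    (by rwa [Real.norm_of_nonneg hq0] : ‖q‖ < 1)).mul_right M
  rw [one_div_mul_eq_div] at hgeom
  refine hasSum_le (fun n => ?_) hexp hgeom
  calc c * ((q * a) ^ n / n.factorial) = q ^ n * (c * (a ^ n / n.factorial)) := by
        rw [mul_pow]; ring
    _ ≤ q ^ n * ((n + m).choose m * M) :=
        mul_le_mul_of_nonneg_left (h n) (pow_nonneg hq0 n)
    _ = (n + m).choose m * q ^ n * M := by ring

theorem eventually_exp_div_lt_of_forall_mul_pow_div_factorial_le (m : ℕ) (hc : 0 < c)
    (hr : 0 ≤ r) (hs : s < r) :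
    ∀ᶠ ρ : ℝ in 𝓝[>] 0, ∀ M : ℝ,
      (∀ n : ℕ, c * (r ^ n / n.factorial) ≤ (n + m).choose m * (ρ ^ (n + 1) * M)) →
        Real.exp (s / ρ) < M := by
  obtain ⟨q, hq0, hq1, hsq⟩ : ∃ q, 0 ≤ q ∧ q < 1 ∧ s ≤ q * r := by
    rcases hr.eq_or_lt with rfl | hr
    · exact ⟨0, le_rfl, one_pos, by simpa using hs.le⟩
    · exact ⟨max 0 (s / r), le_max_left _ _, max_lt one_pos ((div_lt_one hr).2 hs),
        (div_le_iff₀ hr).1 (le_max_right _ _)⟩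
  have hq : 0 < (1 - q) ^ (m + 1) := pow_pos (sub_pos.2 hq1) _
  filter_upwards [Ioo_mem_nhdsGT (mul_pos hc hq)] with ρ ⟨hρ, hρc⟩ M hM
  have hsum : c * Real.exp (q * (r / ρ)) ≤ ρ * M / (1 - q) ^ (m + 1) :=
    mul_exp_le_of_forall_mul_pow_div_factorial_le m hq0 hq1 fun n => by
      rw [div_pow, div_right_comm, mul_div_assoc', div_le_iff₀ (pow_pos hρ n)]
      exact (hM n).trans_eq (by ring)
  rw [le_div_iff₀ hq] at hsum
  refine lt_of_mul_lt_mul_left ?_ hρ.le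
  calc ρ * Real.exp (s / ρ) < c * (1 - q) ^ (m + 1) * Real.exp (s / ρ) := by gcongr
    _ ≤ c * (1 - q) ^ (m + 1) * Real.exp (q * (r / ρ)) := by
        rw [← mul_div_assoc]
        gcongr
    _ = c * Real.exp (q * (r / ρ)) * (1 - q) ^ (m + 1) := by ring
    _ ≤ ρ * M := hsum

theorem eventually_inv_mul_exp_div_mul_le_exp_div (C : ℝ) (hrs : r < s) :
    ∀ᶠ ρ : ℝ in 𝓝[>] 0, ρ⁻¹ * Real.exp (r / ρ) * C ≤ Real.exp (s / ρ) := by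
  have hdecay : Tendsto (fun x : ℝ => x ^ 1 * Real.exp (-(s - r) * x)) atTop (𝓝 0) :=
    (isLittleO_pow_exp_pos_mul_atTop 1 (sub_pos.2 hrs)).tendsto_div_nhds_zero.congr
      fun x => by rw [neg_mul, Real.exp_neg, div_eq_mul_inv]
  have hlim := (hdecay.comp tendsto_inv_nhdsGT_zero).mul_const C
  rw [zero_mul] at hlim
  filter_upwards [hlim.eventually_le_const one_pos] with ρ hρ
  calc ρ⁻¹ * Real.exp (r / ρ) * C
      = ρ⁻¹ ^ 1 * Real.exp (-(s - r) * ρ⁻¹) * C * Real.exp (s / ρ) := by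
        rw [show r / ρ = -(s - r) * ρ⁻¹ + s / ρ by ring, Real.exp_add]
        ring
    _ ≤ Real.exp (s / ρ) := mul_le_of_le_one_left (Real.exp_pos _).le hρ

end Growth

section GeometricSeries

variable {R : Type*} [Ring R] [TopologicalSpace R] [IsTopologicalRing R] [T2Space R] {a : R}

theorem isUnit_one_sub_of_summable_pow (ha : Summable fun n : ℕ => a ^ n) : IsUnit (1 - a) :=
  isUnit_iff_exists.2 ⟨∑' n : ℕ, a ^ n, ha.one_sub_mul_tsum_pow, ha.tsum_pow_mul_one_sub⟩

theorem inverse_one_sub_of_summable_pow (ha : Summable fun n : ℕ => a ^ n) :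
    Ring.inverse (1 - a) = ∑' n : ℕ, a ^ n :=
  Ring.inverse_unit ⟨1 - a, _, ha.one_sub_mul_tsum_pow, ha.tsum_pow_mul_one_sub⟩

end GeometricSeries

section BanachAlgebra

variable {R : Type*} [NormedRing R] [NormedAlgebra ℂ R] {a : R} {r : ℝ} {z : ℂ}

theorem resolvent_eq_inv_smul_inverse_one_sub (a : R) (hz : z ≠ 0) :
    resolvent a z = z⁻¹ • Ring.inverse (1 - z⁻¹ • a) := by
  have h := spectrum.units_smul_resolvent_self (r := Units.mk0 z hz) (a := a)
  simp only [Units.smul_def, Units.val_mk0, Units.val_inv_eq_inv_val, resolvent, map_one] at h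
  rw [← h, resolvent, smul_smul, inv_mul_cancel₀ hz, one_smul]

theorem norm_inv_smul_pow_le (ha : ∀ n : ℕ, ‖a ^ n‖ ≤ r ^ n / n.factorial) (z : ℂ) (n : ℕ) :
    ‖(z⁻¹ • a) ^ n‖ ≤ (r / ‖z‖) ^ n / n.factorial := by
  rw [smul_pow, norm_smul, norm_pow, norm_inv, div_eq_inv_mul r, mul_pow, mul_div_assoc]
  exact mul_le_mul_of_nonneg_left (ha n) (by positivity)

variable [CompleteSpace R]

theorem norm_apply_pow_le_of_norm_apply_resolvent_le {F : Type*} [NormedAddCommGroup F]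
    [NormedSpace ℂ F] [CompleteSpace F] (φ : R →L[ℂ] F) {ρ : NNReal} (hρ : spectralRadius ℂ a < ρ)
    {M : ℝ} (hM : ∀ z : ℂ, ‖z‖ = ρ → ‖φ (resolvent a z)‖ ≤ M) (n : ℕ) :
    ‖φ (a ^ n)‖ ≤ ρ ^ (n + 1) * M := by
  have hρ0 : 0 < ρ := ENNReal.coe_pos.1 (bot_le.trans_lt hρ)
  let f : ℂ → F := fun w => φ (Ring.inverse (1 - w • a))
  have hf : DiffContOnCl ℂ f (Metric.ball 0 (ρ⁻¹ : NNReal)) := by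
    refine (φ.differentiable.comp_differentiableOn ?_).diffContOnCl_ball subset_rfl
    refine spectrum.differentiableOn_inverse_one_sub_smul ?_
    rwa [ENNReal.coe_inv hρ0.ne', ENNReal.inv_lt_inv]
  have hbound : ∀ w ∈ Metric.sphere (0 : ℂ) (ρ⁻¹ : NNReal), ‖f w‖ ≤ ρ * M := fun w hw => by
    have hw' : ‖w‖ = (ρ : ℝ)⁻¹ := by simpa using hw
    have hw0 : w ≠ 0 := norm_pos_iff.1 (hw' ▸ by positivity)
    have h := hM w⁻¹ (by rw [norm_inv, hw', inv_inv])
    rwa [resolvent_eq_inv_smul_inverse_one_sub a (inv_ne_zero hw0), inv_inv, map_smul, norm_smul,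
      hw', inv_mul_le_iff₀ (by exact_mod_cast hρ0)] at h
  have hcoeff : n.factorial • φ (a ^ n) = iteratedDeriv n f 0 := by
    have h : n.factorial • φ (ContinuousMultilinearMap.mkPiRing ℂ (Fin n) (a ^ n) fun _ => 1) =
        iteratedFDeriv ℂ n f 0 fun _ => 1 :=
      (φ.comp_hasFPowerSeriesOnBall
        (spectrum.hasFPowerSeriesOnBall_inverse_one_sub_smul ℂ a)).factorial_smul _ n
    simpa only [iteratedFDeriv_apply_eq_iteratedDeriv_mul_prod,
      ContinuousMultilinearMap.mkPiRing_apply, Finset.prod_const_one, one_smul] using h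
  have hcauchy := Complex.norm_iteratedDeriv_le_of_forall_mem_sphere_norm_le n
    (by positivity) hf hbound
  rw [← hcoeff, ← Nat.cast_smul_eq_nsmul ℂ, norm_smul, Complex.norm_natCast, mul_div_assoc,
    mul_le_mul_iff_right₀ (by positivity)] at hcauchy
  refine hcauchy.trans_eq ?_
  rw [NNReal.coe_inv, inv_pow, div_inv_eq_mul]
  ring

theorem summable_inv_smul_pow_of_norm_pow_le (ha : ∀ n : ℕ, ‖a ^ n‖ ≤ r ^ n / n.factorial)
    (z : ℂ) : Summable fun n : ℕ => (z⁻¹ • a) ^ n :=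
  .of_norm_bounded (Real.summable_pow_div_factorial _) (norm_inv_smul_pow_le ha z)

theorem isUnit_algebraMap_sub_of_norm_pow_le (ha : ∀ n : ℕ, ‖a ^ n‖ ≤ r ^ n / n.factorial)
    (hz : z ≠ 0) : IsUnit (algebraMap ℂ R z - a) := by
  have h := isUnit_one_sub_of_summable_pow (summable_inv_smul_pow_of_norm_pow_le ha z)
  have hfac : algebraMap ℂ R z - a = Units.mk0 z hz • (1 - z⁻¹ • a) := by
    rw [Units.smul_mk0, smul_sub, smul_inv_smul₀ hz, Algebra.algebraMap_eq_smul_one]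
  rw [hfac]
  exact h.smul _

theorem resolvent_eq_inv_smul_tsum_of_norm_pow_le (ha : ∀ n : ℕ, ‖a ^ n‖ ≤ r ^ n / n.factorial)
    (hz : z ≠ 0) : resolvent a z = z⁻¹ • ∑' n : ℕ, (z⁻¹ • a) ^ n := by
  rw [resolvent_eq_inv_smul_inverse_one_sub a hz,
    inverse_one_sub_of_summable_pow (summable_inv_smul_pow_of_norm_pow_le ha z)]

theorem hasSum_resolvent_of_norm_pow_le (ha : ∀ n : ℕ, ‖a ^ n‖ ≤ r ^ n / n.factorial)
    (hz : z ≠ 0) : HasSum (fun n : ℕ => z⁻¹ ^ (n + 1) • a ^ n) (resolvent a z) := by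
  rw [resolvent_eq_inv_smul_tsum_of_norm_pow_le ha hz]
  refine ((summable_inv_smul_pow_of_norm_pow_le ha z).hasSum.const_smul z⁻¹).congr_fun ?_
  exact fun n => by rw [smul_pow, smul_smul, pow_succ']

theorem norm_resolvent_le_of_norm_pow_le (ha : ∀ n : ℕ, ‖a ^ n‖ ≤ r ^ n / n.factorial)
    (hz : z ≠ 0) : ‖resolvent a z‖ ≤ ‖z‖⁻¹ * Real.exp (r / ‖z‖) := by
  have hexp : HasSum (fun n : ℕ => (r / ‖z‖) ^ n / n.factorial) (Real.exp (r / ‖z‖)) := by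
    rw [Real.exp_eq_exp_ℝ]
    exact NormedSpace.expSeries_div_hasSum_exp _
  rw [resolvent_eq_inv_smul_tsum_of_norm_pow_le ha hz, norm_smul, norm_inv]
  gcongr
  exact tsum_of_norm_bounded hexp (norm_inv_smul_pow_le ha z)

theorem spectrum_subset_zero_of_norm_pow_le (ha : ∀ n : ℕ, ‖a ^ n‖ ≤ r ^ n / n.factorial) :
    spectrum ℂ a ⊆ {0} := fun _ hz =>
  by_contra fun hz0 => hz (isUnit_algebraMap_sub_of_norm_pow_le ha hz0)

theorem spectrum_eq_zero_of_norm_pow_le [Nontrivial R]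
    (ha : ∀ n : ℕ, ‖a ^ n‖ ≤ r ^ n / n.factorial) : spectrum ℂ a = {0} :=
  (spectrum.nonempty a).subset_singleton_iff.1 (spectrum_subset_zero_of_norm_pow_le ha)

theorem spectralRadius_eq_zero_of_norm_pow_le (ha : ∀ n : ℕ, ‖a ^ n‖ ≤ r ^ n / n.factorial) :
    spectralRadius ℂ a = 0 := by
  refine le_bot_iff.1 (iSup₂_le fun z hz => ?_)
  rw [spectrum_subset_zero_of_norm_pow_le ha hz, nnnorm_zero, ENNReal.coe_zero]
  exact bot_le

end BanachAlgebra

section ResolventType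

/-- The resolvent of `a` grows like `exp (s / ‖z‖)` as `z → 0`, that is,
`‖z‖ * log ‖resolvent a z‖` tends to `s`. This is the growth scale on which `localPower` compares
a resolvent with its orbits; comparing with exponentials rather than taking logarithms keeps
`log 0 = 0` out of the definition. -/
structure HasResolventType {R : Type*} [NormedRing R] [NormedAlgebra ℂ R] (a : R) (s : ℝ) :
    Prop where
  norm_le : ∀ q > s, ∀ᶠ z : ℂ in 𝓝[≠] 0, ‖resolvent a z‖ ≤ Real.exp (q / ‖z‖)
  lt_norm : ∀ q < s, ∀ᶠ z : ℂ in 𝓝[≠] 0, Real.exp (q / ‖z‖) < ‖resolvent a z‖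

/-- The upper limit of `‖z‖ * log ‖resolvent T z x‖` as `z → 0` is `t`: the analogue of
`HasResolventType` for the orbit of a vector `x`, as an upper limit only because the function
`z ↦ ‖resolvent T z x‖` may drop far below `exp (t / ‖z‖)` in some directions. -/
structure HasLocalResolventType {E : Type*} [NormedAddCommGroup E] [NormedSpace ℂ E]
    (T : E →L[ℂ] E) (x : E) (t : ℝ) : Prop where
  norm_le : ∀ q > t, ∀ᶠ z : ℂ in 𝓝[≠] 0, ‖resolvent T z x‖ ≤ Real.exp (q / ‖z‖)
  lt_norm : ∀ q < t, ∃ᶠ z : ℂ in 𝓝[≠] 0, Real.exp (q / ‖z‖) < ‖resolvent T z x‖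

/-- The powers of `T` decay at least as fast as `r ^ n / n!`, and the resolvent of `T` and all its
orbits at nonzero vectors grow with the largest type which this decay allows, namely `r`. -/
structure HasUniformResolventType {E : Type*} [NormedAddCommGroup E] [NormedSpace ℂ E]
    (T : E →L[ℂ] E) (r : ℝ) : Prop where
  norm_pow_le : ∀ n : ℕ, ‖T ^ n‖ ≤ r ^ n / n.factorial
  hasResolventType : HasResolventType T r
  hasLocalResolventType : ∀ x ≠ 0, HasLocalResolventType T x r

namespace HasResolventType

variable {R : Type*} [NormedRing R] [NormedAlgebra ℂ R] {a : R} {s : ℝ}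

theorem eventually_norm_resolvent_pos (h : HasResolventType a s) :
    ∀ᶠ z : ℂ in 𝓝[≠] 0, 0 < ‖resolvent a z‖ :=
  (h.lt_norm (s - 1) (sub_one_lt s)).mono fun _ hz => (Real.exp_pos _).trans hz

theorem nontrivial (h : HasResolventType a s) : Nontrivial R :=
  have ⟨_, hz⟩ := h.eventually_norm_resolvent_pos.exists
  nontrivial_of_ne _ _ (norm_pos_iff.1 hz)

theorem tendsto_norm_mul_log_norm_resolvent (h : HasResolventType a s) :
    Tendsto (fun z : ℂ => ‖z‖ * Real.log ‖resolvent a z‖) (𝓝[≠] 0) (𝓝 s) := by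
  refine tendsto_order.2 ⟨fun q hq => ?_, fun q hq => ?_⟩
  · filter_upwards [h.lt_norm q hq, self_mem_nhdsWithin] with z hlt hz
    rw [← div_lt_iff₀' (norm_pos_iff.2 hz)]
    exact (Real.lt_log_iff_exp_lt ((Real.exp_pos _).trans hlt)).2 hlt
  · obtain ⟨p, hsp, hpq⟩ := exists_between hq
    filter_upwards [h.norm_le p hsp, h.eventually_norm_resolvent_pos, self_mem_nhdsWithin]
      with z hle hpos hz
    refine lt_of_le_of_lt ?_ hpq
    rw [← le_div_iff₀' (norm_pos_iff.2 hz)]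
    exact (Real.log_le_iff_le_exp hpos).2 hle

end HasResolventType

section NormPowLe

variable {R : Type*} [NormedRing R] [NormedAlgebra ℂ R] [CompleteSpace R] {a : R} {r : ℝ}

theorem eventually_norm_resolvent_mul_le_exp_div
    (ha : ∀ n : ℕ, ‖a ^ n‖ ≤ r ^ n / n.factorial) {C : ℝ} (hC : 0 ≤ C) {q : ℝ} (hq : r < q) :
    ∀ᶠ z : ℂ in 𝓝[≠] 0, ‖resolvent a z‖ * C ≤ Real.exp (q / ‖z‖) := by
  filter_upwards [tendsto_norm_nhdsNE_zero.eventually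
    (eventually_inv_mul_exp_div_mul_le_exp_div C hq), self_mem_nhdsWithin] with z hexp hz
  exact (mul_le_mul_of_nonneg_right (norm_resolvent_le_of_norm_pow_le ha hz) hC).trans hexp

theorem hasResolventType_of_norm_pow_le (ha : ∀ n : ℕ, ‖a ^ n‖ ≤ r ^ n / n.factorial)
    (hlt : ∀ q < r, ∀ᶠ z : ℂ in 𝓝[≠] 0, Real.exp (q / ‖z‖) < ‖resolvent a z‖) :
    HasResolventType a r where
  norm_le q hq := by
    simpa only [mul_one] using eventually_norm_resolvent_mul_le_exp_div ha zero_le_one hq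
  lt_norm := hlt

end NormPowLe

theorem hasLocalResolventType_of_norm_pow_le {E : Type*} [NormedAddCommGroup E] [NormedSpace ℂ E]
    [CompleteSpace E] {T : E →L[ℂ] E} {r : ℝ} (hT : ∀ n : ℕ, ‖T ^ n‖ ≤ r ^ n / n.factorial) {x : E}
    (hlt : ∀ q < r, ∃ᶠ z : ℂ in 𝓝[≠] 0, Real.exp (q / ‖z‖) < ‖resolvent T z x‖) :
    HasLocalResolventType T x r where
  norm_le _ hq := (eventually_norm_resolvent_mul_le_exp_div hT (norm_nonneg x) hq).mono
    fun z hz => ((resolvent T z).le_opNorm x).trans hz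
  lt_norm := hlt

theorem frequently_exp_div_lt_norm_resolvent_apply {E : Type*} [NormedAddCommGroup E]
    [NormedSpace ℂ E] [CompleteSpace E] {T : E →L[ℂ] E} {x : E} (hT : spectralRadius ℂ T = 0)
    {c r : ℝ} (hc : 0 < c) (hr : 0 ≤ r) {m : ℕ}
    (hx : ∀ n : ℕ, c * (r ^ n / n.factorial) ≤ (n + m).choose m * ‖(T ^ n) x‖) {q : ℝ}
    (hq : q < r) : ∃ᶠ z : ℂ in 𝓝[≠] 0, Real.exp (q / ‖z‖) < ‖resolvent T z x‖ := by
  intro hle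
  rw [← comap_norm_nhdsGT_zero, eventually_comap] at hle
  obtain ⟨ρ, hlt, hle, hρ⟩ :=
    ((eventually_exp_div_lt_of_forall_mul_pow_div_factorial_le m hc hr hq).and
      (hle.and self_mem_nhdsWithin)).exists
  lift ρ to NNReal using le_of_lt hρ
  have hcauchy : ∀ n, ‖(T ^ n) x‖ ≤ ρ ^ (n + 1) * Real.exp (q / ρ) :=
    norm_apply_pow_le_of_norm_apply_resolvent_le (ContinuousLinearMap.apply ℂ E x)
      (by rw [hT]; exact_mod_cast hρ) fun z hz => by simpa [hz] using hle z hz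
  refine lt_irrefl _ (hlt _ fun n => (hx n).trans ?_)
  exact mul_le_mul_of_nonneg_left (hcauchy n) (Nat.cast_nonneg _)

variable {E : Type*} [NormedAddCommGroup E] [InnerProductSpace ℂ E] {T : E →L[ℂ] E}

theorem localPower_eq_div {x : E} {s t : ℝ} (hT : HasResolventType T s)
    (hx : HasLocalResolventType T x t) (hs : 0 < s) (ht : 0 ≤ t) : localPower T x = t / s := by
  have hlim := hT.tendsto_norm_mul_log_norm_resolvent
  have hpos := hlim.eventually_const_lt hs
  have hquot : ∀ z : ℂ, z ≠ 0 → Real.log ‖resolvent T z x‖ / Real.log ‖resolvent T z‖ =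
      ‖z‖ * Real.log ‖resolvent T z x‖ / (‖z‖ * Real.log ‖resolvent T z‖) :=
    fun z hz => (mul_div_mul_left _ _ (norm_ne_zero_iff.2 hz)).symm
  refine limsup_eq_of_eventually_lt_of_frequently_lt (fun y hy => ?_) fun y hy => ?_
  · obtain ⟨q, htq, hqy⟩ := exists_between ((div_lt_iff₀ hs).1 hy)
    filter_upwards [hx.norm_le q htq, (hlim.const_mul y).eventually_const_lt hqy, hpos,
      self_mem_nhdsWithin] with z hle hq hden hz
    have hz0 : 0 < ‖z‖ := norm_pos_iff.2 hz
    rw [hquot z hz, div_lt_iff₀ hden]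
    refine lt_of_le_of_lt ?_ hq
    rw [← le_div_iff₀' hz0]
    rcases (norm_nonneg (resolvent T z x)).eq_or_lt with h0 | h0
    · rw [← h0, Real.log_zero]
      exact div_nonneg (ht.trans htq.le) hz0.le
    · exact (Real.log_le_iff_le_exp h0).2 hle
  · obtain ⟨q, hyq, hqt⟩ := exists_between ((lt_div_iff₀ hs).1 hy)
    refine ((hx.lt_norm q hqt).and_eventually (((hlim.const_mul y).eventually_lt_const hyq).and
      (hpos.and self_mem_nhdsWithin))).mono ?_
    rintro z ⟨hlt, hq, hden, hz⟩
    rw [hquot z hz, lt_div_iff₀ hden]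
    refine hq.trans ?_
    rw [← div_lt_iff₀' (norm_pos_iff.2 hz)]
    exact (Real.lt_log_iff_exp_lt ((Real.exp_pos _).trans hlt)).2 hlt

namespace HasUniformResolventType

variable {r : ℝ}

theorem norm_le (hT : HasUniformResolventType T r) : ‖T‖ ≤ r := by
  simpa using hT.norm_pow_le 1

theorem nonneg (hT : HasUniformResolventType T r) : 0 ≤ r :=
  (norm_nonneg T).trans hT.norm_le

theorem nontrivial (hT : HasUniformResolventType T r) : Nontrivial E := by
  have := hT.hasResolventType.nontrivial
  by_contra h
  have := not_nontrivial_iff_subsingleton.1 h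
  exact not_subsingleton (E →L[ℂ] E) inferInstance

theorem isQuasinilpotent [CompleteSpace E] (hT : HasUniformResolventType T r) :
    IsQuasinilpotent T :=
  have := hT.hasResolventType.nontrivial
  spectrum_eq_zero_of_norm_pow_le hT.norm_pow_le

theorem localPower_eq_one (hT : HasUniformResolventType T r) (hr : 0 < r) {x : E} (hx : x ≠ 0) :
    localPower T x = 1 := by
  rw [localPower_eq_div hT.hasResolventType (hT.hasLocalResolventType x hx) hr hr.le,
    div_self hr.ne']

theorem operatorPowerSet_eq_one (hT : HasUniformResolventType T r) (hr : 0 < r) :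
    operatorPowerSet T = {1} := by
  have := hT.nontrivial
  obtain ⟨x₀, hx₀⟩ := exists_ne (0 : E)
  refine Set.eq_singleton_iff_unique_mem.2 ⟨⟨x₀, hx₀, hT.localPower_eq_one hr hx₀⟩, ?_⟩
  rintro _ ⟨x, hx, rfl⟩
  exact hT.localPower_eq_one hr hx

end HasUniformResolventType

end ResolventType

section HilbertBasis

variable {𝕜 E F ι : Type*} [RCLike 𝕜] [NormedAddCommGroup E] [InnerProductSpace 𝕜 E]
  [NormedAddCommGroup F]

theorem countable_of_orthonormal [TopologicalSpace.SeparableSpace E] {v : ι → E}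
    (hv : Orthonormal 𝕜 v) : Countable ι := by
  have hdist : ∀ i j, i ≠ j → 1 ≤ dist (v i) (v j) := fun i j hij => by
    have h := norm_sub_sq (𝕜 := 𝕜) (v i) (v j)
    rw [hv.inner_eq_zero hij, hv.norm_eq_one, hv.norm_eq_one, map_zero] at h
    rw [dist_eq_norm]
    nlinarith [norm_nonneg (v i - v j)]
  refine Pairwise.countable_of_isOpen_disjoint (s := fun i => Metric.ball (v i) (1 / 2))
    (fun i j hij => Metric.ball_disjoint_ball ?_) (fun _ => Metric.isOpen_ball)
    (fun i => ⟨v i, Metric.mem_ball_self one_half_pos⟩)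
  rw [add_halves]
  exact hdist i j hij

theorem infinite_of_hilbertBasis (e : HilbertBasis ι 𝕜 E) (hE : ¬ FiniteDimensional 𝕜 E) :
    Infinite ι := by
  by_contra hfin
  rw [not_infinite_iff_finite] at hfin
  have := Fintype.ofFinite ι
  exact hE e.toOrthonormalBasis.toBasis.finiteDimensional_of_finite

theorem nonempty_hilbertBasis_nat [CompleteSpace E] [TopologicalSpace.SeparableSpace E]
    (hE : ¬ FiniteDimensional 𝕜 E) : Nonempty (HilbertBasis ℕ 𝕜 E) := by
  obtain ⟨s, b, -⟩ := exists_hilbertBasis 𝕜 E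
  have := countable_of_orthonormal b.orthonormal
  have := infinite_of_hilbertBasis b hE
  obtain ⟨f⟩ := nonempty_equiv_of_countable (α := ℕ) (β := s)
  refine ⟨.mk (b.orthonormal.comp f f.injective) ?_⟩
  rw [f.surjective.range_comp, b.dense_span]

theorem continuousLinearMap_ext_hilbertBasis [NormedSpace 𝕜 F] (e : HilbertBasis ι 𝕜 E)
    {S T : E →L[𝕜] F} (h : ∀ i, S (e i) = T (e i)) : S = T := by
  refine ContinuousLinearMap.ext_on (s := Set.range e) ?_ (Set.forall_mem_range.2 h)
  rw [Submodule.dense_iff_topologicalClosure_eq_top, e.dense_span]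

variable [InnerProductSpace 𝕜 F] [CompleteSpace F] {v : ι → F} {w : ι → 𝕜} {K : ℝ}

theorem exists_continuousLinearMap_apply_hilbertBasis_eq_smul (e : HilbertBasis ι 𝕜 E)
    (hv : Orthonormal 𝕜 v) (hK : 0 ≤ K) (hw : ∀ i, ‖w i‖ ≤ K) :
    ∃ W : E →L[𝕜] F, (∀ i, W (e i) = w i • v i) ∧ ‖W‖ ≤ K := by
  classical
  let V := hv.orthogonalFamily.linearIsometry
  let D := lp.mapCLM (E := fun _ : ι => 𝕜) (F := fun _ : ι => 𝕜) 2
    (fun i => w i • ContinuousLinearMap.id 𝕜 𝕜) hK (fun i => by simpa [norm_smul] using hw i)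
  have hD : ∀ i, D (lp.single 2 i 1) = lp.single 2 i (w i) := fun i => by
    ext j
    change w j * lp.single (E := fun _ : ι => 𝕜) 2 i 1 j = _
    rcases eq_or_ne j i with rfl | h
    · simp
    · simp [h]
  refine ⟨V.toContinuousLinearMap ∘L D ∘L e.repr.toLinearIsometry.toContinuousLinearMap,
    fun i => ?_, ContinuousLinearMap.opNorm_le_bound _ hK fun x => ?_⟩
  · simp only [ContinuousLinearMap.comp_apply, LinearIsometry.coe_toContinuousLinearMap,
      LinearIsometryEquiv.coe_toLinearIsometry, HilbertBasis.repr_self, hD]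
    simp [V, OrthogonalFamily.linearIsometry_apply_single]
  · simp only [ContinuousLinearMap.comp_apply, LinearIsometry.coe_toContinuousLinearMap,
      LinearIsometry.norm_map, LinearIsometryEquiv.coe_toLinearIsometry]
    exact (D.le_of_opNorm_le (lp.norm_mapCLM_le ..) _).trans_eq (by rw [e.repr.norm_map])

theorem norm_le_of_apply_hilbertBasis_eq_smul (e : HilbertBasis ι 𝕜 E) (hv : Orthonormal 𝕜 v)
    (hK : 0 ≤ K) (hw : ∀ i, ‖w i‖ ≤ K) {T : E →L[𝕜] F} (hT : ∀ i, T (e i) = w i • v i) :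
    ‖T‖ ≤ K := by
  obtain ⟨W, hW, hWK⟩ := exists_continuousLinearMap_apply_hilbertBasis_eq_smul e hv hK hw
  rwa [continuousLinearMap_ext_hilbertBasis e fun i => (hT i).trans (hW i).symm]

end HilbertBasis

section HarmonicShift

variable {H : Type*} [NormedAddCommGroup H] [InnerProductSpace ℂ H]

/-- The operator `A` is the shift with weights `1, 1/2, 1/3, …` in the orthonormal basis `e`. -/
def IsHarmonicShift (e : HilbertBasis ℕ ℂ H) (A : H →L[ℂ] H) : Prop :=
  ∀ n : ℕ, A (e n) = (1 / ((n : ℂ) + 1)) • e (n + 1)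

variable {e : HilbertBasis ℕ ℂ H} {A : H →L[ℂ] H}

theorem orthonormal_hilbertBasis_add (e : HilbertBasis ℕ ℂ H) (n : ℕ) :
    Orthonormal ℂ fun m => e (m + n) :=
  e.orthonormal.comp _ (add_left_injective n)

theorem exists_isHarmonicShift [CompleteSpace H] (e : HilbertBasis ℕ ℂ H) :
    ∃ A : H →L[ℂ] H, IsHarmonicShift e A := by
  obtain ⟨A, hA, -⟩ := exists_continuousLinearMap_apply_hilbertBasis_eq_smul e
    (orthonormal_hilbertBasis_add e 1) zero_le_one (w := fun n : ℕ => 1 / ((n : ℂ) + 1)) fun n => by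
      rw [norm_div, norm_one, ← Nat.cast_add_one, Complex.norm_natCast]
      exact div_le_one_of_le₀ (by simp) (Nat.cast_nonneg _)
  exact ⟨A, hA⟩

namespace IsHarmonicShift

theorem pow_apply (hA : IsHarmonicShift e A) (n m : ℕ) :
    (A ^ n) (e m) = ((m.factorial : ℂ) / (m + n).factorial) • e (m + n) := by
  induction n with
  | zero => simp [div_self (Nat.cast_ne_zero.2 m.factorial_ne_zero : (m.factorial : ℂ) ≠ 0)]
  | succ n ih =>
    rw [pow_succ', mul_apply_eq_comp, ih, map_smul, hA, smul_smul, ← add_assoc,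
      Nat.factorial_succ]
    congr 1
    push_cast
    rw [div_mul_div_comm, mul_one, mul_comm ((m : ℂ) + n + 1)]

theorem inner_add_pow_apply (hA : IsHarmonicShift e A) (n m : ℕ) (x : H) :
    inner ℂ (e (m + n)) ((A ^ n) x) =
      (m.factorial : ℂ) / (m + n).factorial * inner ℂ (e m) x := by
  have h : (innerSL ℂ (e (m + n))) ∘L A ^ n =
      ((m.factorial : ℂ) / (m + n).factorial) • innerSL ℂ (e m) :=
    continuousLinearMap_ext_hilbertBasis e fun j => by
      rcases eq_or_ne m j with rfl | hmj
      · simp [hA.pow_apply, e.orthonormal.norm_eq_one]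
      · simp [hA.pow_apply, e.orthonormal.inner_eq_zero hmj,
          e.orthonormal.inner_eq_zero ((add_left_injective n).ne hmj)]
  simpa using DFunLike.congr_fun h x

theorem mul_pow_div_factorial_le_norm_pow_apply (hA : IsHarmonicShift e A) (c : ℂ) (m n : ℕ)
    (x : H) : ‖inner ℂ (e m) x‖ * (‖c‖ ^ n / n.factorial) ≤
      (n + m).choose m * ‖((c • A) ^ n) x‖ := by
  have hchoose : ((n + m).choose m : ℝ) * n.factorial * m.factorial = (m + n).factorial := by
    rw [add_comm m n]
    exact_mod_cast Nat.add_choose_mul_factorial_mul_factorial n m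
  have hle : ‖inner ℂ (e (m + n)) (((c • A) ^ n) x)‖ ≤ ‖((c • A) ^ n) x‖ := by
    simpa [e.orthonormal.norm_eq_one] using norm_inner_le_norm (𝕜 := ℂ) (e (m + n)) _
  refine le_trans (le_of_eq ?_) (mul_le_mul_of_nonneg_left hle (Nat.cast_nonneg _))
  rw [smul_pow, FunLike.coe_smul, Pi.smul_apply, inner_smul_right, hA.inner_add_pow_apply,
    norm_mul, norm_mul, norm_div, norm_pow, Complex.norm_natCast, Complex.norm_natCast, ← hchoose]
  have := Nat.choose_pos (Nat.le_add_left m n)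
  field_simp

variable [CompleteSpace H]

theorem norm_pow_le (hA : IsHarmonicShift e A) (n : ℕ) : ‖A ^ n‖ ≤ 1 / n.factorial := by
  refine norm_le_of_apply_hilbertBasis_eq_smul e (orthonormal_hilbertBasis_add e n)
    (by positivity) (fun m => ?_) (hA.pow_apply n)
  rw [norm_div, Complex.norm_natCast, Complex.norm_natCast,
    div_le_div_iff₀ (by positivity) (by positivity), one_mul]
  exact_mod_cast Nat.le_of_dvd (by positivity) (Nat.factorial_mul_factorial_dvd_factorial_add m n)

theorem norm_smul_pow_le (hA : IsHarmonicShift e A) (c : ℂ) (n : ℕ) :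
    ‖(c • A) ^ n‖ ≤ ‖c‖ ^ n / n.factorial := by
  rw [smul_pow, norm_smul, norm_pow, div_eq_mul_one_div]
  gcongr
  exact hA.norm_pow_le n

theorem inner_resolvent_smul_apply (hA : IsHarmonicShift e A) (c : ℂ) {z : ℂ} (hz : z ≠ 0)
    (n : ℕ) : inner ℂ (e n) (resolvent (c • A) z (e 0)) =
      z⁻¹ ^ (n + 1) * (c ^ n / n.factorial) := by
  have hterm : ∀ k, z⁻¹ ^ (k + 1) * (c ^ k / k.factorial) * inner ℂ (e n) (e k) =
      inner ℂ (e n) ((z⁻¹ ^ (k + 1) • (c • A) ^ k) (e 0)) := fun k => by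
    simp only [smul_pow, FunLike.coe_smul, Pi.smul_apply, inner_smul_right, hA.pow_apply,
      Nat.factorial_zero, Nat.cast_one, zero_add]
    ring
  have hsum := (((innerSL ℂ (e n)) ∘L ContinuousLinearMap.apply ℂ H (e 0)).hasSum
    (hasSum_resolvent_of_norm_pow_le (hA.norm_smul_pow_le c) hz)).congr_fun hterm
  refine (hsum.unique (hasSum_single n fun k hk => ?_)).trans ?_
  · rw [e.orthonormal.inner_eq_zero hk.symm, mul_zero]
  · simp [e.orthonormal.norm_eq_one]

theorem pow_div_factorial_le_norm_resolvent_smul (hA : IsHarmonicShift e A) (c : ℂ) {z : ℂ}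
    (hz : z ≠ 0) (n : ℕ) :
    ‖c‖ ^ n / n.factorial ≤ ‖z‖ ^ (n + 1) * ‖resolvent (c • A) z‖ := by
  have hle : ‖inner ℂ (e n) (resolvent (c • A) z (e 0))‖ ≤ ‖resolvent (c • A) z‖ := by
    refine (norm_inner_le_norm _ _).trans ?_
    simpa [e.orthonormal.norm_eq_one] using (resolvent (c • A) z).le_opNorm (e 0)
  rw [hA.inner_resolvent_smul_apply c hz, norm_mul, norm_pow, norm_inv, inv_pow, norm_div,
    norm_pow, Complex.norm_natCast, inv_mul_le_iff₀ (by positivity)] at hle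
  exact hle

theorem hasUniformResolventType_smul (hA : IsHarmonicShift e A) (c : ℂ) :
    HasUniformResolventType (c • A) ‖c‖ where
  norm_pow_le := hA.norm_smul_pow_le c
  hasResolventType := hasResolventType_of_norm_pow_le (hA.norm_smul_pow_le c) fun q hq => by
    filter_upwards [tendsto_norm_nhdsNE_zero.eventually
      (eventually_exp_div_lt_of_forall_mul_pow_div_factorial_le 0 one_pos (norm_nonneg c) hq),
      self_mem_nhdsWithin] with z hlt hz
    refine hlt _ fun n => ?_
    simpa using hA.pow_div_factorial_le_norm_resolvent_smul c hz n
  hasLocalResolventType x hx := by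
    obtain ⟨m, hm⟩ : ∃ m, inner ℂ (e m) x ≠ 0 := by
      by_contra! h
      refine hx (e.repr.injective ?_)
      ext m
      simp [e.repr_apply_apply, h m]
    exact hasLocalResolventType_of_norm_pow_le (hA.norm_smul_pow_le c) fun q hq =>
      frequently_exp_div_lt_norm_resolvent_apply
        (spectralRadius_eq_zero_of_norm_pow_le (hA.norm_smul_pow_le c)) (norm_pos_iff.2 hm)
        (norm_nonneg c) (fun n => hA.mul_pow_div_factorial_le_norm_pow_apply c m n x) hq

end IsHarmonicShift

end HarmonicShift

section DirectSum

theorem smul_resolvent_apply_sub {E : Type*} [NormedAddCommGroup E] [NormedSpace ℂ E]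
    {T : E →L[ℂ] E} {z : ℂ} (h : IsUnit (algebraMap ℂ (E →L[ℂ] E) z - T)) (x : E) :
    z • resolvent T z x - T (resolvent T z x) = x := by
  simpa [resolvent, Algebra.algebraMap_eq_smul_one] using
    DFunLike.congr_fun (Ring.mul_inverse_cancel _ h) x

theorem eq_resolvent_apply {E : Type*} [NormedAddCommGroup E] [NormedSpace ℂ E]
    {T : E →L[ℂ] E} {z : ℂ} (h : IsUnit (algebraMap ℂ (E →L[ℂ] E) z - T)) {x y : E}
    (hy : z • y - T y = x) : y = resolvent T z x := by
  rw [← hy]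
  simpa [resolvent, Algebra.algebraMap_eq_smul_one] using
    (DFunLike.congr_fun (Ring.inverse_mul_cancel _ h) y).symm

theorem lp_norm_le_mul_norm_of_forall_le {ι : Type*} {E F : ι → Type*}
    [∀ i, NormedAddCommGroup (E i)] [∀ i, NormedAddCommGroup (F i)] [∀ i, NormedSpace ℝ (F i)]
    {p : ENNReal} (hp : p ≠ 0) {x : lp E p} {y : lp F p} {K : ℝ} (hK : 0 ≤ K)
    (h : ∀ i, ‖x i‖ ≤ K * ‖y i‖) : ‖x‖ ≤ K * ‖y‖ := by
  rw [← Real.norm_of_nonneg hK, ← lp.norm_const_smul hp]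
  refine lp.norm_mono hp fun i => ?_
  rw [lp.coeFn_smul, Pi.smul_apply, norm_smul, Real.norm_of_nonneg hK]
  exact h i

theorem exists_lp_support_eq {E : Type*} [NormedAddCommGroup E] [NormedSpace ℝ E] [Nontrivial E]
    {p : ENNReal} (hp : 1 ≤ p) (S : Set ℕ) : ∃ x : lp (fun _ : ℕ => E) p, {k | x k ≠ 0} = S := by
  obtain ⟨v, hv⟩ := exists_ne (0 : E)
  let f : ℕ → E := S.indicator fun k => (1 / 2 : ℝ) ^ k • v
  have hbound : ∀ k, ‖f k‖ ≤ (1 / 2) ^ k * ‖v‖ := fun k =>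
    (norm_indicator_le_norm_self _ k).trans_eq (by simp [norm_smul])
  have hf : Memℓp f 1 := memℓp_gen (by
    simpa using Summable.of_nonneg_of_le (fun k => norm_nonneg _) hbound
      (summable_geometric_two.mul_right _))
  refine ⟨⟨f, hf.of_exponent_ge hp⟩, Set.ext fun k => ?_⟩
  change f k ≠ 0 ↔ k ∈ S
  by_cases hk : k ∈ S <;> simp [f, hk, hv]

variable {H : Type*} [NormedAddCommGroup H] [InnerProductSpace ℂ H]
  {B : ℕ → H →L[ℂ] H} {hB : BddAbove (Set.range fun k => ‖B k‖)}

theorem directSumOperator_apply (x : lp (fun _ : ℕ => H) 2) (k : ℕ) :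
    directSumOperator B hB x k = B k (x k) :=
  rfl

theorem directSumOperator_pow_apply (n : ℕ) (x : lp (fun _ : ℕ => H) 2) (k : ℕ) :
    (directSumOperator B hB ^ n) x k = (B k ^ n) (x k) := by
  induction n with
  | zero => simp
  | succ n ih => simp only [pow_succ', mul_apply_eq_comp, directSumOperator_apply, ih]

theorem norm_directSumOperator_pow_le {n : ℕ} {K : ℝ} (hK : 0 ≤ K) (h : ∀ k, ‖B k ^ n‖ ≤ K) :
    ‖directSumOperator B hB ^ n‖ ≤ K :=
  ContinuousLinearMap.opNorm_le_bound _ hK fun x =>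
    lp_norm_le_mul_norm_of_forall_le two_ne_zero hK fun k => by
      rw [directSumOperator_pow_apply]
      exact (B k ^ n).le_of_opNorm_le (h k) (x k)

theorem resolvent_directSumOperator_apply {z : ℂ}
    (h : IsUnit (algebraMap ℂ (lp (fun _ : ℕ => H) 2 →L[ℂ] _) z - directSumOperator B hB))
    {k : ℕ} (hk : IsUnit (algebraMap ℂ (H →L[ℂ] H) z - B k)) (x : lp (fun _ : ℕ => H) 2) :
    resolvent (directSumOperator B hB) z x k = resolvent (B k) z (x k) :=
  eq_resolvent_apply hk
    (congrArg (fun y : lp (fun _ : ℕ => H) 2 => y k) (smul_resolvent_apply_sub h x))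

theorem norm_resolvent_le_norm_resolvent_directSumOperator {z : ℂ}
    (h : IsUnit (algebraMap ℂ (lp (fun _ : ℕ => H) 2 →L[ℂ] _) z - directSumOperator B hB))
    {k : ℕ} (hk : IsUnit (algebraMap ℂ (H →L[ℂ] H) z - B k)) :
    ‖resolvent (B k) z‖ ≤ ‖resolvent (directSumOperator B hB) z‖ := by
  refine (resolvent (B k) z).opNorm_le_bound (norm_nonneg (resolvent (directSumOperator B hB) z))
    fun x => ?_
  have hcoord := resolvent_directSumOperator_apply h hk (lp.single 2 k x)
  rw [lp.single_apply_self] at hcoord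
  calc ‖resolvent (B k) z x‖ = ‖resolvent (directSumOperator B hB) z (lp.single 2 k x) k‖ :=
        congrArg norm hcoord.symm
    _ ≤ ‖resolvent (directSumOperator B hB) z (lp.single 2 k x)‖ :=
        lp.norm_apply_le_norm two_ne_zero _ k
    _ ≤ ‖resolvent (directSumOperator B hB) z‖ * ‖lp.single (E := fun _ : ℕ => H) 2 k x‖ :=
        ContinuousLinearMap.le_opNorm _ _
    _ = ‖resolvent (directSumOperator B hB) z‖ * ‖x‖ := by rw [lp.norm_single two_pos]

variable {r : ℕ → ℝ} {M : ℝ}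

theorem norm_directSumOperator_pow_le_of_hasUniformResolventType
    (hr : ∀ k, HasUniformResolventType (B k) (r k)) (hM : ∀ k, r k ≤ M) (n : ℕ) :
    ‖directSumOperator B hB ^ n‖ ≤ M ^ n / n.factorial := by
  have hM0 : 0 ≤ M := (hr 0).nonneg.trans (hM 0)
  refine norm_directSumOperator_pow_le (by positivity) fun k => ((hr k).norm_pow_le n).trans ?_
  have := (hr k).nonneg
  gcongr
  exact hM k

variable [CompleteSpace H]

theorem isUnit_algebraMap_sub_directSumOperator
    (hr : ∀ k, HasUniformResolventType (B k) (r k)) (hM : ∀ k, r k ≤ M) {z : ℂ} (hz : z ≠ 0) :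
    IsUnit (algebraMap ℂ (lp (fun _ : ℕ => H) 2 →L[ℂ] _) z - directSumOperator B hB) :=
  isUnit_algebraMap_sub_of_norm_pow_le
    (norm_directSumOperator_pow_le_of_hasUniformResolventType hr hM) hz

theorem hasResolventType_directSumOperator (hr : ∀ k, HasUniformResolventType (B k) (r k))
    (hM : IsLUB (Set.range r) M) : HasResolventType (directSumOperator B hB) M := by
  have hle : ∀ k, r k ≤ M := Set.forall_mem_range.1 hM.1
  refine hasResolventType_of_norm_pow_le
    (norm_directSumOperator_pow_le_of_hasUniformResolventType hr hle) fun q hq => ?_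
  obtain ⟨_, ⟨k, rfl⟩, hqk⟩ := (lt_isLUB_iff hM).1 hq
  filter_upwards [(hr k).hasResolventType.lt_norm q hqk, self_mem_nhdsWithin] with z hlt hz
  have hunit := isUnit_algebraMap_sub_directSumOperator (hB := hB) hr hle hz
  have hunitk := isUnit_algebraMap_sub_of_norm_pow_le (hr k).norm_pow_le hz
  exact hlt.trans_le (norm_resolvent_le_norm_resolvent_directSumOperator hunit hunitk)

theorem hasLocalResolventType_directSumOperator
    (hr : ∀ k, HasUniformResolventType (B k) (r k)) (hM : ∀ k, r k ≤ M)
    {x : lp (fun _ : ℕ => H) 2} {t : ℝ} (ht : IsLUB (r '' {k | x k ≠ 0}) t) :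
    HasLocalResolventType (directSumOperator B hB) x t := by
  have happly : ∀ z : ℂ, z ≠ 0 → ∀ k,
      resolvent (directSumOperator B hB) z x k = resolvent (B k) z (x k) := fun z hz k => by
    have hunit := isUnit_algebraMap_sub_directSumOperator (hB := hB) hr hM hz
    have hunitk := isUnit_algebraMap_sub_of_norm_pow_le (hr k).norm_pow_le hz
    exact resolvent_directSumOperator_apply hunit hunitk x
  refine ⟨fun q hq => ?_, fun q hq => ?_⟩
  · filter_upwards [tendsto_norm_nhdsNE_zero.eventually
      (eventually_inv_mul_exp_div_mul_le_exp_div ‖x‖ hq), self_mem_nhdsWithin] with z hexp hz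
    refine le_trans ?_ hexp
    refine lp_norm_le_mul_norm_of_forall_le two_ne_zero (by positivity) fun k => ?_
    rw [happly z hz]
    by_cases hk : x k = 0
    · simp [hk]
    · refine (ContinuousLinearMap.le_of_opNorm_le _
        (norm_resolvent_le_of_norm_pow_le (hr k).norm_pow_le hz) _).trans ?_
      gcongr
      exact ht.1 ⟨k, hk, rfl⟩
  · obtain ⟨_, ⟨k, hk, rfl⟩, hqk⟩ := (lt_isLUB_iff ht).1 hq
    refine ((((hr k).hasLocalResolventType (x k) hk).lt_norm q hqk).and_eventually
      self_mem_nhdsWithin).mono fun z ⟨hlt, hz⟩ => ?_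
    rw [← happly z hz] at hlt
    exact hlt.trans_le (lp.norm_apply_le_norm two_ne_zero _ k)

theorem isQuasinilpotent_directSumOperator (hr : ∀ k, HasUniformResolventType (B k) (r k))
    (hM : IsLUB (Set.range r) M) : IsQuasinilpotent (directSumOperator B hB) :=
  have := (hasResolventType_directSumOperator (hB := hB) hr hM).nontrivial
  spectrum_eq_zero_of_norm_pow_le
    (norm_directSumOperator_pow_le_of_hasUniformResolventType hr (Set.forall_mem_range.1 hM.1))

theorem localPower_directSumOperator (hr : ∀ k, HasUniformResolventType (B k) (r k))
    (hM : IsLUB (Set.range r) M) (hM0 : 0 < M) {x : lp (fun _ : ℕ => H) 2} (hx : x ≠ 0) {t : ℝ}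
    (ht : IsLUB (r '' {k | x k ≠ 0}) t) : localPower (directSumOperator B hB) x = t / M := by
  obtain ⟨k, hk⟩ : ∃ k, x k ≠ 0 := by
    by_contra! h
    exact hx (by ext k; simp [h k])
  exact localPower_eq_div (hasResolventType_directSumOperator hr hM)
    (hasLocalResolventType_directSumOperator hr (Set.forall_mem_range.1 hM.1) ht) hM0
    ((hr k).nonneg.trans (ht.1 ⟨k, hk, rfl⟩))

theorem operatorPowerSet_directSumOperator (hr : ∀ k, HasUniformResolventType (B k) (r k))
    (hM : IsLUB (Set.range r) M) (hM0 : 0 < M) :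
    operatorPowerSet (directSumOperator B hB) =
      {t | ∃ S : Set ℕ, S.Nonempty ∧ IsLUB (r '' S) (t * M)} := by
  have hne : ∀ x : lp (fun _ : ℕ => H) 2, x ≠ 0 ↔ {k | x k ≠ 0}.Nonempty := fun x => by
    rw [Ne, lp.ext_iff, funext_iff, not_forall]
    rfl
  ext t
  constructor
  · rintro ⟨x, hx, rfl⟩
    have hlub := isLUB_csSup (((hne x).1 hx).image r)
      (hM.bddAbove.mono (Set.image_subset_range r _))
    refine ⟨_, (hne x).1 hx, ?_⟩
    rwa [localPower_directSumOperator hr hM hM0 hx hlub, div_mul_cancel₀ _ hM0.ne']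
  · rintro ⟨S, hS, hlub⟩
    have := (hr 0).nontrivial
    obtain ⟨x, rfl⟩ := exists_lp_support_eq (E := H) one_le_two S
    refine ⟨x, (hne x).2 hS, ?_⟩
    rw [localPower_directSumOperator hr hM hM0 ((hne x).2 hS) hlub, mul_div_cancel_right₀ _ hM0.ne']

end DirectSum

theorem exists_injective_range_eq {α : Type*} {s : Set α} (hs : s.Countable) (hs' : s.Infinite) :
    ∃ r : ℕ → α, Function.Injective r ∧ Set.range r = s := by
  have := hs.to_subtype
  have := hs'.to_subtype
  obtain ⟨f⟩ := nonempty_equiv_of_countable (α := ℕ) (β := s)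
  exact ⟨Subtype.val ∘ f, Subtype.val_injective.comp f.injective,
    by rw [f.surjective.range_comp, Subtype.range_coe]⟩

section RationalEnumeration

variable {ι : Type*} {r : ι → ℚ} {a b : ℚ}

theorem isLUB_range_ratCast (hr : Set.range r = Set.Ioc a b) (hab : a < b) :
    IsLUB (Set.range fun k => (r k : ℝ)) b := by
  have hcast : (Set.range fun k => (r k : ℝ)) = (↑) '' Set.Ioc a b := by
    rw [← hr, ← Set.range_comp]
    rfl
  rw [hcast]
  refine IsGreatest.isLUB ⟨Set.mem_image_of_mem _ (Set.right_mem_Ioc.2 hab), ?_⟩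
  rintro _ ⟨q, hq, rfl⟩
  exact_mod_cast hq.2

theorem setOf_isLUB_image_ratCast (hr : Set.range r = Set.Ioc a b) :
    {t : ℝ | ∃ S : Set ι, S.Nonempty ∧ IsLUB ((fun k => (r k : ℝ)) '' S) t} = Set.Ioc ↑a ↑b := by
  have hmem : ∀ k, r k ∈ Set.Ioc a b := fun k => hr ▸ Set.mem_range_self k
  ext t
  constructor
  · rintro ⟨S, ⟨k, hk⟩, ht⟩
    refine ⟨lt_of_lt_of_le ?_ (ht.1 ⟨k, hk, rfl⟩), ht.2 ?_⟩
    · exact Rat.cast_lt.2 (hmem k).1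
    · rintro _ ⟨j, -, rfl⟩
      exact Rat.cast_le.2 (hmem j).2
  · rintro ⟨hat, htb⟩
    have hdense : ∀ c : ℝ, a ≤ c → c < t → ∃ k, c < r k ∧ (r k : ℝ) < t := fun c hac hct => by
      obtain ⟨q, hcq, hqt⟩ := exists_rat_btwn hct
      obtain ⟨k, rfl⟩ : q ∈ Set.range r := hr ▸
        ⟨by exact_mod_cast hac.trans_lt hcq, by exact_mod_cast (hqt.trans_le htb).le⟩
      exact ⟨k, hcq, hqt⟩
    obtain ⟨k, -, hk⟩ := hdense a le_rfl hat
    refine ⟨{k | (r k : ℝ) ≤ t}, ⟨k, hk.le⟩, by rintro _ ⟨k, hk, rfl⟩; exact hk, fun c hc => ?_⟩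
    by_contra! hct
    obtain ⟨k, hck, hkt⟩ := hdense (max c a) (le_max_right _ _) (max_lt hct hat)
    exact (hc ⟨k, hkt.le, rfl⟩).not_gt ((le_max_left _ _).trans_lt hck)

end RationalEnumeration

theorem mainTheorem6 {H : Type*} [NormedAddCommGroup H] [InnerProductSpace ℂ H]
    [CompleteSpace H] [TopologicalSpace.SeparableSpace H] (hH : ¬ FiniteDimensional ℂ H) :
    -- the weighted shift `A` with weights `1, 1/2, 1/3, …` in an orthonormal basis `e` of `H`,
    -- and an enumeration `r` of the rationals in `(0, 1]`
    ∃ (e : HilbertBasis ℕ ℂ H) (A : H →L[ℂ] H) (r : ℕ → ℚ) (B : ℕ → H →L[ℂ] H),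
      (∀ n : ℕ, A (e n) = (1 / ((n : ℂ) + 1)) • e (n + 1)) ∧
      Function.Injective r ∧ Set.range r = Set.Ioc 0 1 ∧
      (∀ k, B k = (r k : ℂ) • A) ∧
      (∀ k, IsQuasinilpotent (B k)) ∧
      (∀ k, operatorPowerSet (B k) = {1}) ∧
      ∃ hB : BddAbove (Set.range fun k => ‖B k‖),
        IsQuasinilpotent (directSumOperator B hB) ∧
        operatorPowerSet (directSumOperator B hB) = Set.Ioc 0 1 ∧
        closure (⋃ k, operatorPowerSet (B k)) ⊂ operatorPowerSet (directSumOperator B hB) := by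
  obtain ⟨e⟩ := nonempty_hilbertBasis_nat hH
  obtain ⟨A, hA⟩ := exists_isHarmonicShift e
  obtain ⟨r, hinj, hrange⟩ :=
    exists_injective_range_eq (Set.Ioc (0 : ℚ) 1).to_countable (Set.Ioc_infinite one_pos)
  have hpos : ∀ k, (0 : ℝ) < r k := fun k => by
    exact_mod_cast (hrange ▸ Set.mem_range_self k : r k ∈ Set.Ioc 0 1).1
  have htype : ∀ k, HasUniformResolventType ((r k : ℂ) • A) (r k) := fun k => by
    simpa [abs_of_pos (hpos k)] using hA.hasUniformResolventType_smul (r k)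
  have hLUB : IsLUB (Set.range fun k => (r k : ℝ)) 1 := by
    exact_mod_cast isLUB_range_ratCast hrange one_pos
  have hB : BddAbove (Set.range fun k => ‖(r k : ℂ) • A‖) :=
    hLUB.bddAbove.range_mono _ fun k => (htype k).norm_le
  have hone : ∀ k, operatorPowerSet ((r k : ℂ) • A) = {1} := fun k =>
    (htype k).operatorPowerSet_eq_one (hpos k)
  have hsum : operatorPowerSet (directSumOperator (fun k => (r k : ℂ) • A) hB) = Set.Ioc 0 1 := by
    simpa [setOf_isLUB_image_ratCast hrange] using
      operatorPowerSet_directSumOperator (hB := hB) htype hLUB one_pos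
  refine ⟨e, A, r, fun k => (r k : ℂ) • A, hA, hinj, hrange, fun _ => rfl,
    fun k => (htype k).isQuasinilpotent, hone, hB, isQuasinilpotent_directSumOperator htype hLUB,
    hsum, ?_⟩
  simp only [hsum, hone, Set.iUnion_const, closure_singleton]
  exact Set.ssubset_iff_exists.2 ⟨by simp, 1 / 2, by norm_num, by norm_num⟩
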